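/- Let $s \ge 1$ and $n \ge 2s+1$ be coprime integers. For an integer $m \ge 1$ and a real phase $\phi$ let $Z(s,n,m,\phi)$ be the closed billiard curve $t \mapsto (f_{1,2}(t), f_3(t))$, $t \in [0,1]$, in the cylinder $\{(z,x) \in \mathbb{C}\times\mathbb{R} : |z|\le 1,\ 0\le x\le 1\}$, where $f_{1,2}$ is the closed polygon, traversed proportionally to arc length, with $f_{1,2}(k/n) = e^{2\pi i s k/n}$ for $k = 0,\dots,n$, and $f_3(t) = g(mt+\phi)$ with $g(t) = 2\,\bigl|t - \lfloor t\rfloor - \tfrac12\bigr|$. If this curve has no self-intersections, it is a cylinder knot $Z(s,n,m)$. Read counterclockwise around the axis of the cylinder, it is then the closure of an $s$-string braid word $$\prod_{i=1}^{n}\Bigl[\prod_{\substack{1\le j<s\\ j\ \mathrm{odd}}}\sigma_j^{\varepsilon_{i,j}}\prod_{\substack{1\le j<s\\ j\ \mathrm{even}}}\sigma_j^{\varepsilon_{i,j}}\Bigr],\qquad \varepsilon_{i,j}\in\{\pm1\},$$ where the strings are numbered from the centre outwards and $\varepsilon_{i,j}=+1$ if and only if at the crossing $(i,j)$ the left string (the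 one nearer to the centre just before the crossing) lies above the right one. Identify two such braid words (that is, crossing-sign patterns $(\varepsilon_{i,j})$, $i\in\mathbb{Z}/n$, $1\le j<s$) if they are related by rotations of the closed braid diagram (rotations by multiples of $2\pi/n$ about the axis of the cylinder, and rotations by $\pi$ about symmetry axes of the projection in the diagram plane) and by mirroring (changing all crossings). Then for given $s$ and $n$ there are, up to this identification, at most $(n+1)\,2^{s-3}$ different cylinder braids, i.e. braid words arising from curves $Z(s,n,m,\phi)$ without self-intersections, over all $m\ge 1$ and all $\phi$. -/

import Mathlib

noncomputable section

namespace CylinderBraid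

/-- The projection of the billiard curve to the unit disk, extended to `ℝ` with period `1`: a closed
polygon traversed proportionally to arc length which is at the vertex `exp (2π i s k / n)` at time
`k / n`, and which runs along a straight chord between consecutive vertices. -/
def proj (s n : ℕ) (t : ℝ) : ℂ :=
  (1 - ((Int.fract (n * t) : ℝ) : ℂ)) *
      Complex.exp (2 * Real.pi * Complex.I * ((s : ℂ) / (n : ℂ)) * ((⌊n * t⌋ : ℤ) : ℂ)) +
    ((Int.fract (n * t) : ℝ) : ℂ) *
      Complex.exp (2 * Real.pi * Complex.I * ((s : ℂ) / (n : ℂ)) * (((⌊n * t⌋ : ℤ) : ℂ) + 1))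

/-- The sawtooth function `g`. -/
def saw (t : ℝ) : ℝ := 2 * |t - ⌊t⌋ - 1 / 2|

/-- The height function of the billiard curve with `m` maxima and phase `φ`. -/
def height (m : ℕ) (φ t : ℝ) : ℝ := saw (m * t + φ)

/-- The closed billiard curve `Z(s, n, m, φ)` in the cylinder `D² × [0, 1]` (period `1`). -/
def curve (s n m : ℕ) (φ t : ℝ) : ℂ × ℝ := (proj s n t, height m φ t)

/-- `Z(s, n, m, φ)` is a knot: the closed curve has no self-intersection. -/
def IsKnot (s n m : ℕ) (φ : ℝ) : Prop := Set.InjOn (curve s n m φ) (Set.Ico 0 1)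

/-- The point of the disk where the crossing of `σ_j ^ ε_{i,j}` lies. The double points of the
projection that have a given distance from the centre lie on `n` equally spaced rays; the possible
distances are `cos (π s / n) / cos (π j / n)`, `1 ≤ j < s`, increasing in `j`. Going
counterclockwise, one meets alternately a ray with all the double points with `j` odd and a ray with
all the double points with `j` even; the `i`-th block of the braid consists of one ray with `j` odd
and the next one, with `j` even. -/
def crossingPoint (s n : ℕ) (i : ℤ) (j : ℕ) : ℂ :=
  ((Real.cos (Real.pi * s / n) / Real.cos (Real.pi * j / n) : ℝ) : ℂ) *
    Complex.exp (Real.pi * Complex.I * ((2 * (i : ℂ) + (s : ℂ) + (if Odd j then 1 else 2)) / (n : ℂ)))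

/-- `x` and `y` are parameters of the crossing `(i, j)`, where `x` belongs to the left string and `y`
to the right string. The braid is read counterclockwise around the centre, so the left string is the
one that is closer to the centre just before the crossing. -/
def IsCrossing (s n : ℕ) (i : ℤ) (j : ℕ) (x y : ℝ) : Prop :=
  proj s n x = crossingPoint s n i j ∧ proj s n y = crossingPoint s n i j ∧
    ∃ δ > 0, ∀ h, 0 < h → h < δ → ‖proj s n (x - h)‖ < ‖proj s n (y - h)‖

/-- Crossing-sign patterns `ε_{i,j} = ±1`, for `i ∈ ℤ/n` and `j = 1, …, s - 1` (the element `j` of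
`Fin (s - 1)` stands for the index `j + 1`). The pattern `ε` encodes the closed braid word
`∏_{i = 1}^{n} (∏_{j odd} σ_j ^ ε_{i,j}) (∏_{j even} σ_j ^ ε_{i,j})`. -/
abbrev Pattern (s n : ℕ) : Type := ZMod n → Fin (s - 1) → ℤˣ

/-- `ε` is the crossing-sign pattern of the billiard curve `Z(s, n, m, φ)`: the sign is `+1` where
the left string is above the right one and `-1` otherwise. -/
def IsPatternOf (s n m : ℕ) (φ : ℝ) (ε : Pattern s n) : Prop :=
  ∀ (i : ℤ) (j : Fin (s - 1)) (x y : ℝ), IsCrossing s n i (j + 1) x y →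
    (ε i j = 1 ↔ height m φ y < height m φ x)

/-- The crossing-sign patterns of all cylinder knots `Z(s, n, m)` with `m ≥ 1` maxima. -/
def cylinderPatterns (s n : ℕ) : Set (Pattern s n) :=
  {ε | ∃ (m : ℕ) (φ : ℝ), 0 < m ∧ IsKnot s n m φ ∧ IsPatternOf s n m φ ε}

/-- Rotation of the closed braid by `2π / n` about the axis of the cylinder. -/
def rotate {s n : ℕ} (ε : Pattern s n) : Pattern s n := fun i j => ε (i + 1) j

/-- Mirror image in the diagram plane: all crossings are changed. -/
def mirror {s n : ℕ} (ε : Pattern s n) : Pattern s n := fun i j => -ε i j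

/-- Rotation by `π` about an axis in the diagram plane, through the centre and the crossings `(0, j)`
with `j` odd. Crossing signs are preserved and the cyclic order of the rays is reversed; the rays with
`j` even lie halfway between those with `j` odd, which accounts for the shift. -/
def flip {s n : ℕ} (ε : Pattern s n) : Pattern s n :=
  fun i j => ε (if Odd (j.val + 1) then -i else -1 - i) j

/-- Two patterns are identified if they are related by rotations and mirror images. (Mirror images in
vertical planes through the axis of the cylinder are compositions of the three operations.) -/
def identification (s n : ℕ) : Setoid (Pattern s n) :=
  Relation.EqvGen.setoid fun ε ε' => ε' = rotate ε ∨ ε' = mirror ε ∨ ε' = flip ε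

/-- The cylinder braids for given `s`, `n`, up to rotation and mirroring. -/
def cylinderBraids (s n : ℕ) : Set (Quotient (identification s n)) :=
  Quotient.mk (identification s n) '' cylinderPatterns s n

end CylinderBraid

end

namespace CylinderBraid

/-! At a crossing with parameters `x`, `y`, comparing the heights amounts to the parity of ⌊X + Y⌋ +
⌊Y - X⌋ for the phases X = mx + φ, Y = my + φ (`saw_lt_saw_iff`). The sum X + Y is determined by the
ray of the crossing, the difference Y - X modulo integers by its distance from the centre. With p an
inverse of s modulo n and q = mp, every cylinder braid is therefore a wave (-1)^⌊(q(2i + c_j) +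
c)/n⌋ δ_j (`IsPatternOf.exists_wavePattern`).

Up to rotation, flip and mirroring the phase c can be made 0 (`waveClass_eq_zero_phase`). Replacing
q by -q changes nothing, and q + n amounts to a sign change of δ at odd indices, so 0 ≤ q ≤ n/2
suffices (`exists_waveClass_small_freq`). Mirroring identifies δ with -δ, leaving 2^(s-2) choices.

For odd n there are (n+1)/2 frequencies, giving (n+1) 2^(s-3). For even n, the frequency n/2 is
fixed by q ↦ n - q, so δ is also identified with its twist there, and the count is (n/2) 2^(s-2) +
2^(s-3), the same number. -/

/-- The ray carrying the crossings with index `j + 1`: `1` for odd and `2` for even index. -/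
def ray (j : ℕ) : ℤ := if Odd (j + 1) then 1 else 2

/-- The pattern `ε_{i,j} = (-1) ^ ⌊(q (2 i + c_j) + c) / n⌋ δ_j`, where `c_j` is the ray of `j`. -/
def wavePattern (s n : ℕ) (q c : ℤ) (δ : Fin (s - 1) → ℤˣ) : Pattern s n :=
  fun i j => ((q * (2 * (i.val : ℤ) + ray j) + c) / (n : ℤ)).negOnePow * δ j

/-- The class of a wave pattern up to rotation and mirroring. -/
def waveClass (s n : ℕ) (q c : ℤ) (δ : Fin (s - 1) → ℤˣ) : Quotient (identification s n) :=
  Quotient.mk _ (wavePattern s n q c δ)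

/-- Change the signs of all entries with odd index. -/
def twist {r : ℕ} (δ : Fin r → ℤˣ) : Fin r → ℤˣ := fun j => (ray j).negOnePow * δ j

/-! ### Symmetries of wave patterns: normalising the phase -/

theorem mk_rotate {s n : ℕ} (ε : Pattern s n) :
    Quotient.mk (identification s n) (rotate ε) = Quotient.mk _ ε :=
  Eq.symm <| Quotient.sound <| Relation.EqvGen.rel _ _ <| Or.inl rfl

theorem mk_mirror {s n : ℕ} (ε : Pattern s n) :
    Quotient.mk (identification s n) (mirror ε) = Quotient.mk _ ε :=
  Eq.symm <| Quotient.sound <| Relation.EqvGen.rel _ _ <| Or.inr <| Or.inl rfl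

theorem mk_flip {s n : ℕ} (ε : Pattern s n) :
    Quotient.mk (identification s n) (flip ε) = Quotient.mk _ ε :=
  Eq.symm <| Quotient.sound <| Relation.EqvGen.rel _ _ <| Or.inr <| Or.inr rfl

theorem wavePattern_intCast {s n : ℕ} (hn : 0 < n) (q c : ℤ) (δ : Fin (s - 1) → ℤˣ) (i : ℤ)
    (j : Fin (s - 1)) : wavePattern s n q c δ (i : ZMod n) j =
      ((q * (2 * i + ray j) + c) / (n : ℤ)).negOnePow * δ j := by
  have : NeZero n := ⟨hn.ne'⟩
  have hn' : (n : ℤ) ≠ 0 := by exact_mod_cast hn.ne'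
  have h : q * (2 * i + ray j) + c
      = q * (2 * (i % n) + ray j) + c + (2 * (q * (i / n))) * n := by
    linear_combination (-2 * q) * (Int.emod_add_mul_ediv i n)
  rw [wavePattern, ZMod.val_intCast, h, Int.add_mul_ediv_right _ _ hn', Int.negOnePow_add,
    Int.negOnePow_even _ (even_two_mul _), mul_one]

theorem pattern_ext {s n : ℕ} {ε ε' : Pattern s n} (h : ∀ (i : ℤ) j, ε i j = ε' i j) : ε = ε' := by
  funext i j
  obtain ⟨i, rfl⟩ := ZMod.intCast_surjective i
  exact h i j

theorem neg_ediv_eq {n : ℤ} (hn : 0 < n) (x : ℤ) : (-x) / n = -1 - (x - 1) / n := by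
  have h1 := Int.emod_add_mul_ediv (x - 1) n
  have h2 := Int.emod_nonneg (x - 1) hn.ne'
  have h3 := Int.emod_lt_of_pos (x - 1) hn
  rw [Int.ediv_eq_iff_of_pos hn]
  constructor <;> linarith

theorem negOnePow_neg_one_sub (x : ℤ) : (-1 - x).negOnePow = -x.negOnePow := by
  rw [Int.negOnePow_sub, Int.negOnePow_neg, Int.negOnePow_one, neg_one_mul]

theorem waveClass_neg_right {s n : ℕ} (q c : ℤ) (δ : Fin (s - 1) → ℤˣ) :
    waveClass s n q c (-δ) = waveClass s n q c δ := by
  rw [waveClass, ← mk_mirror, waveClass]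
  congr 1
  funext i j
  simp [mirror, wavePattern]

theorem waveClass_add_two_mul {s n : ℕ} (hn : 0 < n) (q c : ℤ) (δ : Fin (s - 1) → ℤˣ) :
    waveClass s n q (c + 2 * q) δ = waveClass s n q c δ := by
  rw [waveClass, waveClass, ← mk_rotate (wavePattern s n q c δ)]
  congr 1
  refine pattern_ext fun i j => ?_
  have : (i : ZMod n) + 1 = ((i + 1 : ℤ) : ZMod n) := by push_cast; rfl
  rw [rotate, this, wavePattern_intCast hn, wavePattern_intCast hn]
  congr 3
  ring

/-- Every floor grows by one, so all signs change, which is a mirroring. -/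
theorem waveClass_add_period {s n : ℕ} (hn : 0 < n) (q c : ℤ) (δ : Fin (s - 1) → ℤˣ) :
    waveClass s n q (c + n) δ = waveClass s n q c δ := by
  have hn' : (n : ℤ) ≠ 0 := by exact_mod_cast hn.ne'
  rw [← waveClass_neg_right, waveClass, waveClass]
  congr 1
  refine pattern_ext fun i j => ?_
  rw [wavePattern_intCast hn, wavePattern_intCast hn, ← add_assoc]
  rw [Int.add_ediv_of_dvd_right (dvd_refl _), Int.ediv_self hn', Int.negOnePow_succ]
  simp

/-- The flip reflects the ray number 2i + c_j to 2 - (2i + c_j). Negating the argument of a floor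
then costs the `-1` in the phase and a global sign. -/
theorem waveClass_flip {s n : ℕ} (hn : 0 < n) (q c : ℤ) (δ : Fin (s - 1) → ℤˣ) :
    waveClass s n q (-1 - c - 2 * q) δ = waveClass s n q c δ := by
  have hn' : (0 : ℤ) < n := by exact_mod_cast hn
  rw [← waveClass_neg_right q c, waveClass, waveClass, ← mk_flip (wavePattern s n q c (-δ))]
  congr 1
  refine pattern_ext fun i j => ?_
  have key : flip (wavePattern s n q c (-δ)) (i : ZMod n) j =
      ((q * (2 - (2 * i + ray j)) + c) / (n : ℤ)).negOnePow * (-δ) j := by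
    unfold flip
    split_ifs with hj
    · have : -(i : ZMod n) = ((-i : ℤ) : ZMod n) := by push_cast; rfl
      rw [this, wavePattern_intCast hn]
      simp only [ray, if_pos hj]
      congr 3
      ring
    · have : -1 - (i : ZMod n) = ((-1 - i : ℤ) : ZMod n) := by push_cast; rfl
      rw [this, wavePattern_intCast hn]
      simp only [ray, if_neg hj]
      congr 3
      ring
  have h : q * (2 - (2 * i + ray j)) + c = -(q * (2 * i + ray j) - c - 2 * q) := by ring
  rw [key, wavePattern_intCast hn, h, neg_ediv_eq hn', negOnePow_neg_one_sub, Pi.neg_apply, neg_mul_neg]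
  congr 3
  ring

theorem waveClass_add_mul {s n : ℕ} (hn : 0 < n) (q c : ℤ) (δ : Fin (s - 1) → ℤˣ)
    (k : ℤ) : waveClass s n q (c + k * (2 * q)) δ = waveClass s n q c δ := by
  induction k using Int.induction_on generalizing c with
  | zero => simp
  | succ k ih =>
    rw [show c + ((k : ℤ) + 1) * (2 * q) = c + k * (2 * q) + 2 * q by ring,
      waveClass_add_two_mul hn, ih]
  | pred k ih =>
    rw [← waveClass_add_two_mul hn, show c + (-(k : ℤ) - 1) * (2 * q) + 2 * q
      = c + -k * (2 * q) by ring, ih]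

theorem waveClass_add_mul_period {s n : ℕ} (hn : 0 < n) (q c : ℤ) (δ : Fin (s - 1) → ℤˣ)
    (k : ℤ) :
    waveClass s n q (c + k * n) δ = waveClass s n q c δ := by
  induction k using Int.induction_on generalizing c with
  | zero => simp
  | succ k ih =>
    rw [show c + ((k : ℤ) + 1) * n = c + k * n + n by ring, waveClass_add_period hn, ih]
  | pred k ih =>
    rw [← waveClass_add_period hn, show c + (-(k : ℤ) - 1) * n + n = c + -k * n by ring, ih]

/-- Dividing numerator and denominator by d = gcd(q, n) shows that the floors see c only through
⌊c/d⌋. -/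
theorem waveClass_eq_of_ediv_gcd {s n : ℕ} (hn : 0 < n) (q : ℤ) (δ : Fin (s - 1) → ℤˣ)
    {c c' : ℤ} (h : c / (Int.gcd q n : ℤ) = c' / (Int.gcd q n : ℤ)) :
    waveClass s n q c δ = waveClass s n q c' δ := by
  have hn' : (0 : ℤ) < n := by exact_mod_cast hn
  have hd : (0 : ℤ) < Int.gcd q n := by
    exact_mod_cast Int.gcd_pos_of_ne_zero_right q hn'.ne'
  rw [waveClass, waveClass]
  congr 1
  refine pattern_ext fun i j => ?_
  rw [wavePattern_intCast hn, wavePattern_intCast hn]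
  congr 2
  obtain ⟨q', hq⟩ := Int.gcd_dvd_left q n
  obtain ⟨n', hnn⟩ := Int.gcd_dvd_right q n
  have key : ∀ e : ℤ, (q * (2 * i + ray j) + e) / (n : ℤ) =
      (q' * (2 * i + ray j) + e / (Int.gcd q n : ℤ)) / n' := by
    intro e
    have : q * (2 * i + ray j) + e = e + Int.gcd q n * (q' * (2 * i + ray j)) := by
      linear_combination (2 * i + ray j) * hq
    rw [this, show (q' * (2 * i + ray j) + e / (Int.gcd q n : ℤ)) / n' =
      (e + Int.gcd q n * (q' * (2 * i + ray j))) / (Int.gcd q n * n') by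
        rw [← Int.ediv_ediv_of_nonneg hd.le, Int.add_mul_ediv_left _ _ hd.ne', add_comm], ← hnn]
  rw [key, key, h]

/-- By Bézout, the admissible phase shifts 2q and 2n generate all multiples of 2 gcd(q, n). -/
theorem waveClass_of_even_ediv {s n : ℕ} (hn : 0 < n) (q c : ℤ) (δ : Fin (s - 1) → ℤˣ)
    (h : Even (c / (Int.gcd q n : ℤ))) :
    waveClass s n q c δ = waveClass s n q 0 δ := by
  have hn' : (0 : ℤ) < n := by exact_mod_cast hn
  have hd : (0 : ℤ) < Int.gcd q n := by
    exact_mod_cast Int.gcd_pos_of_ne_zero_right q hn'.ne'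
  obtain ⟨l, hl⟩ := h
  have hb := Int.gcd_eq_gcd_ab q n
  rw [waveClass_eq_of_ediv_gcd hn q δ (c' := 0 + (l * Int.gcdA q n) * (2 * q)
    + (2 * l * Int.gcdB q n) * n), waveClass_add_mul_period hn, waveClass_add_mul hn]
  have : 0 + (l * Int.gcdA q n) * (2 * q) + (2 * l * Int.gcdB q n) * n
      = (l + l) * (Int.gcd q n : ℤ) := by linear_combination (-2 * l) * hb
  rw [this, Int.mul_ediv_cancel _ hd.ne', hl]

/-- The phase of a wave is irrelevant up to rotation and mirroring. -/
theorem waveClass_eq_zero_phase {s n : ℕ} (hn : 0 < n) (q c : ℤ) (δ : Fin (s - 1) → ℤˣ) :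
    waveClass s n q c δ = waveClass s n q 0 δ := by
  have hn' : (0 : ℤ) < n := by exact_mod_cast hn
  have hd : (0 : ℤ) < Int.gcd q n := by
    exact_mod_cast Int.gcd_pos_of_ne_zero_right q hn'.ne'
  rcases Int.even_or_odd (c / (Int.gcd q n : ℤ)) with h | h
  · exact waveClass_of_even_ediv hn q c δ h
  -- The flip changes the parity of ⌊c/d⌋: it becomes -1 - ⌊c/d⌋ - 2q/d.
  · rw [← waveClass_flip hn]
    apply waveClass_of_even_ediv hn
    obtain ⟨q', hq⟩ := Int.gcd_dvd_left q n
    have : -1 - c - 2 * q = -(c + 1) + (Int.gcd q n : ℤ) * (-2 * q') := by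
      linear_combination (-2) * hq
    rw [this, Int.add_mul_ediv_left _ _ hd.ne', neg_ediv_eq hd, add_sub_cancel_right]
    obtain ⟨l, hl⟩ := h
    exact ⟨-1 - l - q', by rw [hl]; ring⟩

/-! ### Reducing the frequency to at most n/2 -/

theorem waveClass_add_freq {s n : ℕ} (hn : 0 < n) (q : ℤ) (δ : Fin (s - 1) → ℤˣ) :
    waveClass s n (q + n) 0 δ = waveClass s n q 0 (twist δ) := by
  have hn' : (n : ℤ) ≠ 0 := by exact_mod_cast hn.ne'
  rw [waveClass, waveClass]
  congr 1
  refine pattern_ext fun i j => ?_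
  rw [wavePattern_intCast hn, wavePattern_intCast hn, twist, ← mul_assoc]
  have : (q + n) * (2 * i + ray j) + 0 = q * (2 * i + ray j) + 0 + (2 * i + ray j) * n := by ring
  rw [this, Int.add_mul_ediv_right _ _ hn', Int.negOnePow_add _ (2 * i + ray j),
    Int.negOnePow_add (2 * i), Int.negOnePow_even _ (even_two_mul _), one_mul]

theorem waveClass_neg_freq {s n : ℕ} (hn : 0 < n) (q : ℤ) (δ : Fin (s - 1) → ℤˣ) :
    waveClass s n (-q) 0 δ = waveClass s n q 0 δ := by
  have hn' : (0 : ℤ) < n := by exact_mod_cast hn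
  rw [← waveClass_eq_zero_phase hn q (-1), ← waveClass_neg_right q, waveClass, waveClass]
  congr 1
  refine pattern_ext fun i j => ?_
  have : -q * (2 * i + ray j) + 0 = -(q * (2 * i + ray j)) := by ring
  rw [wavePattern_intCast hn, wavePattern_intCast hn, this, neg_ediv_eq hn', negOnePow_neg_one_sub,
    Pi.neg_apply, mul_neg, neg_mul]
  rfl

theorem twist_twist {r : ℕ} (δ : Fin r → ℤˣ) : twist (twist δ) = δ := by
  funext j
  simp [twist, ← mul_assoc]

theorem exists_waveClass_mul_freq {s n : ℕ} (hn : 0 < n) (q : ℤ) (δ : Fin (s - 1) → ℤˣ)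
    (k : ℤ) :
    ∃ δ', waveClass s n (q + k * n) 0 δ = waveClass s n q 0 δ' := by
  induction k using Int.induction_on generalizing δ with
  | zero => exact ⟨δ, by simp⟩
  | succ k ih =>
    rw [show q + ((k : ℤ) + 1) * n = q + k * n + n by ring, waveClass_add_freq hn]
    exact ih _
  | pred k ih =>
    obtain ⟨δ', h⟩ := ih (twist δ)
    refine ⟨δ', ?_⟩
    rw [← h, ← twist_twist δ, ← waveClass_add_freq hn, twist_twist]
    congr 1
    ring

theorem exists_waveClass_small_freq {s n : ℕ} (hn : 0 < n) (q c : ℤ) (δ : Fin (s - 1) → ℤˣ) :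
    ∃ (k : ℕ) (δ' : Fin (s - 1) → ℤˣ), 2 * k ≤ n ∧ waveClass s n q c δ = waveClass s n k 0 δ' := by
  have hn' : (0 : ℤ) < n := by exact_mod_cast hn
  have h1 := Int.emod_add_mul_ediv q n
  have h2 := Int.emod_nonneg q hn'.ne'
  have h3 := Int.emod_lt_of_pos q hn'
  rw [waveClass_eq_zero_phase hn]
  by_cases h : 2 * (q % n) ≤ n
  · obtain ⟨δ', hδ⟩ := exists_waveClass_mul_freq hn (q % n) δ (q / n)
    refine ⟨(q % n).toNat, δ', by omega, ?_⟩
    rw [Int.toNat_of_nonneg h2, ← hδ]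
    congr 1
    linarith
  -- A residue in the upper half is represented by its negative remainder, whose sign is then
  -- dropped.
  · obtain ⟨δ', hδ⟩ := exists_waveClass_mul_freq hn (-(n - q % n)) δ (q / n + 1)
    refine ⟨(n - q % n).toNat, δ', by omega, ?_⟩
    rw [Int.toNat_of_nonneg (by omega), ← waveClass_neg_freq hn (n - q % n), ← hδ]
    congr 1
    linarith

/-- Here -k + n = k, so negation followed by a shift by n returns to the same frequency. -/
theorem waveClass_twist_half {s n : ℕ} (hn : 0 < n) (δ : Fin (s - 1) → ℤˣ)
    {k : ℕ} (hk : 2 * k = n) :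
    waveClass s n k 0 (twist δ) = waveClass s n k 0 δ := by
  rw [← waveClass_neg_freq hn, ← waveClass_add_freq hn]
  congr 1
  have : (n : ℤ) = 2 * k := by exact_mod_cast hk.symm
  rw [this]
  ring

/-! ### Geometry of chords and crossings -/

/-- The projection on the `a`-th chord, with the parameter measured from the midpoint. -/
theorem proj_chord {s n : ℕ} (hn : 0 < n) (a : ℤ) (σ : ℝ) (h1 : -(1 / 2) < σ) (h2 : σ < 1 / 2) :
    proj s n ((a + 1 / 2 + σ) / n) = Complex.exp (Real.pi * (s * (2 * a + 1) / n) * Complex.I) *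
      ((Real.cos (Real.pi * s / n) : ℂ) + (2 * σ * Real.sin (Real.pi * s / n) : ℝ) * Complex.I) := by
  have hn' : (n : ℝ) ≠ 0 := by exact_mod_cast hn.ne'
  have hnc : (n : ℂ) ≠ 0 := by exact_mod_cast hn.ne'
  have e1 : (n : ℝ) * ((a + 1 / 2 + σ) / n) = a + (1 / 2 + σ) := by field_simp; ring
  have e2 : ⌊(a : ℝ) + (1 / 2 + σ)⌋ = a := by
    rw [Int.floor_eq_iff]; constructor <;> linarith
  have e3 : Int.fract ((a : ℝ) + (1 / 2 + σ)) = 1 / 2 + σ := by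
    rw [Int.fract, e2]; ring
  rw [proj, e1, e2, e3]
  set θ : ℝ := Real.pi * s / n with hθ
  have f1 : (2 * Real.pi * Complex.I * ((s : ℂ) / (n : ℂ)) * (a : ℂ)) =
      Real.pi * (s * (2 * a + 1) / n) * Complex.I + ((-θ : ℝ) : ℂ) * Complex.I := by
    rw [hθ]; push_cast; field_simp; ring
  have f2 : (2 * Real.pi * Complex.I * ((s : ℂ) / (n : ℂ)) * ((a : ℂ) + 1)) =
      Real.pi * (s * (2 * a + 1) / n) * Complex.I + (θ : ℂ) * Complex.I := by
    rw [hθ]; push_cast; field_simp; ring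
  rw [f1, f2, Complex.exp_add, Complex.exp_add, Complex.exp_mul_I (θ : ℂ),
    Complex.exp_mul_I ((-θ : ℝ) : ℂ)]
  push_cast
  rw [Complex.cos_neg, Complex.sin_neg]
  ring

theorem norm_proj_chord {s n : ℕ} (hn : 0 < n) (a : ℤ) (σ : ℝ) (h1 : -(1 / 2) < σ)
    (h2 : σ < 1 / 2) : ‖proj s n ((a + 1 / 2 + σ) / n)‖ =
      √(Real.cos (Real.pi * s / n) ^ 2 + (2 * σ * Real.sin (Real.pi * s / n)) ^ 2) := by
  rw [proj_chord hn a σ h1 h2, norm_mul]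
  have : (Real.pi * (s * (2 * a + 1) / n) * Complex.I : ℂ) =
      ((Real.pi * (s * (2 * a + 1) / n) : ℝ) : ℂ) * Complex.I := by push_cast; rfl
  rw [this, Complex.norm_exp_ofReal_mul_I, one_mul, Complex.norm_add_mul_I]

/-- The position of a crossing with index `j` on a chord, relative to the midpoint. -/
noncomputable def crossingOffset (s n j : ℕ) : ℝ :=
  Real.tan (Real.pi * j / n) / (2 * Real.tan (Real.pi * s / n))

section

variable {s n j : ℕ}

theorem angle_pos (hn : 2 * s + 1 ≤ n) (hj : 0 < j) : 0 < Real.pi * j / n := by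
  have : (0 : ℝ) < n := by exact_mod_cast (by omega : 0 < n)
  have : (0 : ℝ) < j := by exact_mod_cast hj
  have := Real.pi_pos
  positivity

theorem angle_lt (hn : 2 * s + 1 ≤ n) (hj : j ≤ s) : Real.pi * j / n < Real.pi / 2 := by
  have h0 : (0 : ℝ) < n := by exact_mod_cast (by omega : 0 < n)
  have h1 : (2 : ℝ) * j < n := by exact_mod_cast (by omega : 2 * j < n)
  have := Real.pi_pos
  rw [div_lt_div_iff₀ h0 two_pos]
  nlinarith

theorem crossingOffset_pos (hn : 2 * s + 1 ≤ n) (hj : 0 < j) (hjs : j < s) :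
    0 < crossingOffset s n j := by
  have h1 := Real.tan_pos_of_pos_of_lt_pi_div_two (angle_pos hn hj) (angle_lt hn hjs.le)
  have h2 := Real.tan_pos_of_pos_of_lt_pi_div_two (angle_pos hn (hj.trans hjs)) (angle_lt hn le_rfl)
  unfold crossingOffset
  positivity

theorem crossingOffset_lt (hn : 2 * s + 1 ≤ n) (hj : 0 < j) (hjs : j < s) :
    crossingOffset s n j < 1 / 2 := by
  have h0 : (0 : ℝ) < n := by exact_mod_cast (by omega : 0 < n)
  have h2 := Real.tan_pos_of_pos_of_lt_pi_div_two (angle_pos hn (hj.trans hjs)) (angle_lt hn le_rfl)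
  have h3 : Real.tan (Real.pi * j / n) < Real.tan (Real.pi * s / n) := by
    apply Real.tan_lt_tan_of_nonneg_of_lt_pi_div_two (angle_pos hn hj).le (angle_lt hn le_rfl)
    have : (j : ℝ) < s := by exact_mod_cast hjs
    gcongr
  unfold crossingOffset
  rw [div_lt_div_iff₀ (by positivity) two_pos]
  linarith

theorem two_mul_crossingOffset_mul_sin (hn : 2 * s + 1 ≤ n) (hj : 0 < j) (hjs : j < s) :
    2 * crossingOffset s n j * Real.sin (Real.pi * s / n) =
      Real.cos (Real.pi * s / n) / Real.cos (Real.pi * j / n) * Real.sin (Real.pi * j / n) := by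
  have a1 := angle_pos hn (hj.trans hjs)
  have a2 := angle_lt hn (le_refl s)
  have h1 := Real.sin_pos_of_pos_of_lt_pi a1 (by linarith [Real.pi_pos])
  have h2 := Real.cos_pos_of_mem_Ioo ⟨by linarith [Real.pi_pos], a2⟩
  have h3 := Real.cos_pos_of_mem_Ioo
    ⟨by linarith [Real.pi_pos, angle_pos hn hj], angle_lt hn hjs.le⟩
  rw [crossingOffset, Real.tan_eq_sin_div_cos, Real.tan_eq_sin_div_cos]
  field_simp

/-- The point at a signed offset from the midpoint of a chord, in polar coordinates. -/
theorem proj_eq_crossingPoint (hn : 2 * s + 1 ≤ n) (hj : 0 < j) (hjs : j < s) (i a w : ℤ) (e : ℤ)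
    (he : e = 1 ∨ e = -1)
    (ha : s * (2 * a + 1) + e * j = 2 * i + s + (if Odd j then 1 else 2) + 2 * n * w) :
    proj s n ((a + 1 / 2 + e * crossingOffset s n j) / n) = crossingPoint s n i j := by
  have hn0 : 0 < n := by omega
  have hnc : (n : ℂ) ≠ 0 := by exact_mod_cast hn0.ne'
  have p1 := crossingOffset_pos hn hj hjs
  have p2 := crossingOffset_lt hn hj hjs
  have h3 := Real.cos_pos_of_mem_Ioo
    ⟨by linarith [Real.pi_pos, angle_pos hn hj], angle_lt hn hjs.le⟩
  have hpolar : ((Real.cos (Real.pi * s / n) : ℂ) +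
      (2 * (e * crossingOffset s n j) * Real.sin (Real.pi * s / n) : ℝ) * Complex.I) =
      ((Real.cos (Real.pi * s / n) / Real.cos (Real.pi * j / n) : ℝ) : ℂ) *
        Complex.exp (((e * (Real.pi * j / n) : ℝ) : ℂ) * Complex.I) := by
    have h4 : 2 * (e * crossingOffset s n j) * Real.sin (Real.pi * s / n) =
        Real.cos (Real.pi * s / n) / Real.cos (Real.pi * j / n) *
          Real.sin (e * (Real.pi * j / n)) := by
      have := two_mul_crossingOffset_mul_sin hn hj hjs
      rcases he with rfl | rfl
      · push_cast; simp only [one_mul]; exact this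
      · push_cast; simp only [neg_mul, one_mul, Real.sin_neg]; linarith
    have h5 : Real.cos (Real.pi * s / n) = Real.cos (Real.pi * s / n) / Real.cos (Real.pi * j / n) *
          Real.cos (e * (Real.pi * j / n)) := by
      rcases he with rfl | rfl
      · push_cast; rw [one_mul]; field_simp
      · push_cast; simp only [neg_mul, one_mul, Real.cos_neg]; field_simp
    rw [h4, Complex.exp_mul_I, ← Complex.ofReal_cos, ← Complex.ofReal_sin]
    nth_rewrite 1 [h5]
    push_cast
    ring
  rw [proj_chord hn0, hpolar, crossingPoint, mul_left_comm, ← Complex.exp_add]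
  · congr 1
    rw [Complex.exp_eq_exp_iff_exists_int]
    refine ⟨w, ?_⟩
    have hc : (s * (2 * a + 1) + e * j : ℂ) = 2 * i + s + (if Odd j then 1 else 2) + 2 * n * w := by
      have := congrArg (Int.cast : ℤ → ℂ) ha
      push_cast at this
      exact this
    have : (Real.pi * (s * (2 * a + 1) / n) * Complex.I +
        ((e * (Real.pi * j / n) : ℝ) : ℂ) * Complex.I : ℂ) =
        Real.pi * Complex.I * ((s * (2 * a + 1) + e * j) / n) := by
      push_cast; ring
    rw [this, hc]
    field_simp
  · rcases he with rfl | rfl <;> push_cast <;> linarith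
  · rcases he with rfl | rfl <;> push_cast <;> linarith

/-- The congruences match the polar angles. The first string is past its chord's midpoint and moving
outwards, the second is still approaching its own, so the first was nearer to the centre just
before. -/
theorem isCrossing_chords (hn : 2 * s + 1 ≤ n) (hj : 0 < j) (hjs : j < s) (i a b w w' : ℤ)
    (ha : s * (2 * a + 1) + j = 2 * i + s + (if Odd j then 1 else 2) + 2 * n * w)
    (hb : s * (2 * b + 1) - j = 2 * i + s + (if Odd j then 1 else 2) + 2 * n * w') :
    IsCrossing s n i j ((a + 1 / 2 + crossingOffset s n j) / n)
      ((b + 1 / 2 - crossingOffset s n j) / n) := by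
  have hn0 : 0 < n := by omega
  have hnr : (0 : ℝ) < n := by exact_mod_cast hn0
  have p1 := crossingOffset_pos hn hj hjs
  have p2 := crossingOffset_lt hn hj hjs
  have a1 := angle_pos hn (hj.trans hjs)
  have a2 := angle_lt hn (le_refl s)
  have h1 := Real.sin_pos_of_pos_of_lt_pi a1 (by linarith [Real.pi_pos])
  refine ⟨?_, ?_, ?_⟩
  · have := proj_eq_crossingPoint hn hj hjs i a w 1 (Or.inl rfl) (by rw [one_mul]; exact ha)
    simpa using this
  · have := proj_eq_crossingPoint hn hj hjs i b w' (-1) (Or.inr rfl)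
      (by rw [neg_one_mul]; exact hb)
    simpa [sub_eq_add_neg] using this
  · set τ := crossingOffset s n j
    -- Within this bound both parameters stay inside their chords.
    refine ⟨min τ (1 / 2 - τ) / n, div_pos (lt_min p1 (by linarith)) hnr, fun h hpos hlt => ?_⟩
    rw [lt_div_iff₀ hnr] at hlt
    have g1 := hlt.trans_le (min_le_left _ _)
    have g2 := hlt.trans_le (min_le_right _ _)
    have g3 : 0 < h * n := by positivity
    have ex : ((a : ℝ) + 1 / 2 + τ) / n - h = (a + 1 / 2 + (τ - h * n)) / n := by field_simp; ring
    have ey : ((b : ℝ) + 1 / 2 - τ) / n - h = (b + 1 / 2 + (-τ - h * n)) / n := by field_simp; ring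
    rw [ex, ey, norm_proj_chord hn0 _ _ (by linarith) (by linarith),
      norm_proj_chord hn0 _ _ (by linarith) (by linarith)]
    apply Real.sqrt_lt_sqrt (by positivity)
    have : (τ - h * n) ^ 2 < (-τ - h * n) ^ 2 := by nlinarith
    have := mul_lt_mul_of_pos_right this (pow_pos h1 2)
    simp only [mul_pow]
    linarith

end

/-! ### Periodicity, heights and crossing signs -/

theorem proj_add_int {s n : ℕ} (hn : 0 < n) (t : ℝ) (z : ℤ) : proj s n (t + z) = proj s n t := by
  have hnc : (n : ℂ) ≠ 0 := by exact_mod_cast hn.ne'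
  have e : (n : ℝ) * (t + z) = n * t + ((n * z : ℤ) : ℝ) := by push_cast; ring
  have h (u : ℂ) : Complex.exp (2 * Real.pi * Complex.I * ((s : ℂ) / n) * (u + n * z)) =
      Complex.exp (2 * Real.pi * Complex.I * ((s : ℂ) / n) * u) := by
    rw [Complex.exp_eq_exp_iff_exists_int]
    refine ⟨s * z, ?_⟩
    push_cast
    field_simp
  rw [proj, proj, e, Int.floor_add_intCast, Int.fract_add_intCast]
  push_cast
  rw [add_right_comm _ _ (1 : ℂ), h, h]

theorem saw_add_int (t : ℝ) (z : ℤ) : saw (t + z) = saw t := by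
  rw [saw, saw, Int.floor_add_intCast]
  push_cast
  congr 2
  ring

theorem height_add_int (m : ℕ) (φ t : ℝ) (z : ℤ) : height m φ (t + z) = height m φ t := by
  rw [height, height, ← saw_add_int (m * t + φ) (m * z)]
  congr 1
  push_cast
  ring

theorem IsKnot.height_ne {s n m : ℕ} {φ : ℝ} (hn : 0 < n) (hk : IsKnot s n m φ) {x y : ℝ}
    (hp : proj s n x = proj s n y) (hxy : ∀ z : ℤ, x - y ≠ z) : height m φ x ≠ height m φ y := by
  intro hh
  have hf (t : ℝ) : curve s n m φ (Int.fract t) = curve s n m φ t := by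
    have : Int.fract t = t + ((-⌊t⌋ : ℤ) : ℝ) := by rw [Int.fract]; push_cast; ring
    rw [curve, curve, this, proj_add_int hn, height_add_int]
  have h : Int.fract x = Int.fract y := by
    refine hk ⟨Int.fract_nonneg _, Int.fract_lt_one _⟩ ⟨Int.fract_nonneg _, Int.fract_lt_one _⟩ ?_
    rw [hf, hf, curve, curve, hp, hh]
  obtain ⟨z, hz⟩ := Int.fract_eq_fract.1 h
  exact hxy z hz

/-- Comparison of two values of the sawtooth function in terms of the parity of integer parts. -/
theorem saw_lt_saw_iff {x y : ℝ} (h : saw x ≠ saw y) :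
    saw y < saw x ↔ Even (⌊x + y⌋ + ⌊y - x⌋) := by
  have hx : saw x = 2 * |Int.fract x - 1 / 2| := rfl
  have hy : saw y = 2 * |Int.fract y - 1 / 2| := rfl
  have ex := Int.floor_add_fract x
  have ey := Int.floor_add_fract y
  have e1 : ⌊x + y⌋ = ⌊x⌋ + ⌊y⌋ + ⌊Int.fract x + Int.fract y⌋ := by
    rw [← Int.floor_intCast_add]
    congr 1
    push_cast
    linarith
  have e2 : ⌊y - x⌋ = ⌊y⌋ - ⌊x⌋ + ⌊Int.fract y - Int.fract x⌋ := by
    rw [← Int.floor_intCast_add]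
    congr 1
    push_cast
    linarith
  -- With α, β the fractional parts, (α - 1/2)² - (β - 1/2)² = (α - β)(α + β - 1); the two floors
  -- detect the signs of these factors.
  have hlt : saw y < saw x ↔
      0 < (Int.fract x - Int.fract y) * (Int.fract x + Int.fract y - 1) := by
    rw [hx, hy, mul_lt_mul_iff_right₀ two_pos, ← sq_lt_sq, ← sub_pos]
    ring_nf
  have hne : (Int.fract x - Int.fract y) * (Int.fract x + Int.fract y - 1) ≠ 0 := by
    intro h0
    apply h
    rw [hx, hy, (sq_eq_sq_iff_abs_eq_abs _ _).1]
    linarith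
  rw [hlt, e1, e2, show ⌊x⌋ + ⌊y⌋ + ⌊Int.fract x + Int.fract y⌋ +
    (⌊y⌋ - ⌊x⌋ + ⌊Int.fract y - Int.fract x⌋) = 2 * ⌊y⌋ +
      (⌊Int.fract x + Int.fract y⌋ + ⌊Int.fract y - Int.fract x⌋) by ring,
    Int.even_add, iff_true_left (even_two_mul _)]
  have a0 := Int.fract_nonneg x
  have a1 := Int.fract_lt_one x
  have b0 := Int.fract_nonneg y
  have b1 := Int.fract_lt_one y
  generalize Int.fract x = α at *
  generalize Int.fract y = β at *
  have hs : ⌊α + β⌋ = if 1 ≤ α + β then 1 else 0 := by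
    split_ifs <;> rw [Int.floor_eq_iff] <;> constructor <;> push_cast <;> linarith
  have hd : ⌊β - α⌋ = if β < α then -1 else 0 := by
    split_ifs <;> rw [Int.floor_eq_iff] <;> constructor <;> push_cast <;> linarith
  rw [hs, hd]
  split_ifs with c1 c2 c2
  · exact iff_of_true (lt_of_le_of_ne (mul_nonneg (by linarith) (by linarith)) hne.symm) (by decide)
  · exact iff_of_false (not_lt.2 (mul_nonpos_of_nonpos_of_nonneg (by linarith) (by linarith)))
      (by decide)
  · exact iff_of_false (not_lt.2 (mul_nonpos_of_nonneg_of_nonpos (by linarith) (by linarith)))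
      (by decide)
  · exact iff_of_true (lt_of_le_of_ne (mul_nonneg_of_nonpos_of_nonpos (by linarith) (by linarith))
      hne.symm) (by decide)

theorem floor_int_add_div {n : ℕ} (z : ℤ) (Ψ : ℝ) : ⌊((z : ℝ) + Ψ) / n⌋ = (z + ⌊Ψ⌋) / n := by
  rw [Int.floor_div_natCast, Int.floor_intCast_add]

theorem two_dvd_ray_sub (j : ℕ) : (2 : ℤ) ∣ ray j - ((j + 1 : ℕ) : ℤ) := by
  unfold ray
  split_ifs with h
  · obtain ⟨k, hk⟩ := h; omega
  · rw [Nat.not_odd_iff_even] at h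
    obtain ⟨k, hk⟩ := h; omega

/-- The crossing-sign pattern of a cylinder knot is a wave pattern. -/
theorem IsPatternOf.exists_wavePattern {s n m : ℕ} {φ : ℝ} {ε : Pattern s n}
    (hcop : Nat.Coprime s n) (hn : 2 * s + 1 ≤ n) (hk : IsKnot s n m φ)
    (hε : IsPatternOf s n m φ ε) : ∃ q c δ, ε = wavePattern s n q c δ := by
  have hn0 : 0 < n := by omega
  have hnr : (n : ℝ) ≠ 0 := by exact_mod_cast hn0.ne'
  obtain ⟨p, w, hpw⟩ : ∃ p w : ℤ, s * p = 1 + n * w := by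
    refine ⟨Nat.gcdA s n, -Nat.gcdB s n, ?_⟩
    have := Nat.gcd_eq_gcd_ab s n
    rw [hcop.gcd_eq_one] at this
    push_cast at this
    linarith
  -- Frequency and phase are read off from the sum of the two saw arguments, δ from their
  -- difference.
  refine ⟨m * p, ⌊(m : ℝ) + 2 * φ * n⌋, fun j => (⌊(m : ℝ) * (p * ((j : ℕ) + 1 : ℕ) -
    2 * crossingOffset s n (j + 1)) / n⌋).negOnePow, pattern_ext fun i j => ?_⟩
  rw [wavePattern_intCast hn0, ← Int.negOnePow_add]
  obtain ⟨l, hl⟩ := two_dvd_ray_sub j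
  have hj : 0 < (j : ℕ) + 1 := by omega
  have hjs : (j : ℕ) + 1 < s := by have := j.2; omega
  have p1 := crossingOffset_pos hn hj hjs
  have p2 := crossingOffset_lt hn hj hjs
  have hif : (if Odd ((j : ℕ) + 1) then 1 else 2 : ℤ) = ray j := rfl
  set J : ℕ := (j : ℕ) + 1 with hJ
  set τ := crossingOffset s n J with hτ
  -- Multiplication by p solves the angle congruences modulo n; l corrects the ray `ray j` to the
  -- index J.
  have hcr := isCrossing_chords hn hj hjs i (p * (i + l)) (p * (i + l) + p * J) (w * (i + l))
    (w * (i + l + J)) (by rw [hif]; linear_combination (2 * (i + l)) * hpw - hl)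
    (by rw [hif]; linear_combination (2 * (i + l + J)) * hpw - hl)
  rw [← hτ] at hcr
  have hne := hk.height_ne hn0 (hcr.1.trans hcr.2.1.symm) (by
    -- Otherwise 2τ would be an integer, but 0 < 2τ < 1.
    intro z hz
    have h1 : 2 * τ = ((n * z + p * J : ℤ) : ℝ) := by
      field_simp at hz
      push_cast at hz ⊢
      linarith
    have h2 : (0 : ℝ) < ((n * z + p * J : ℤ) : ℝ) := by linarith
    have h3 : ((n * z + p * J : ℤ) : ℝ) < 1 := by linarith
    norm_cast at h2 h3
    omega)
  have hval := hε i j _ _ hcr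
  rw [height, height] at hne
  rw [height, height, saw_lt_saw_iff hne] at hval
  have hlr : (2 : ℝ) * l = ray j - J := by
    have := congrArg (Int.cast : ℤ → ℝ) hl
    push_cast at this
    rw [this]
  have hsum : ((m : ℝ) * ((((p * (i + l) : ℤ) : ℝ) + 1 / 2 + τ) / n) + φ +
      ((m : ℝ) * ((((p * (i + l) + p * J : ℤ) : ℝ) + 1 / 2 - τ) / n) + φ)) =
      (((m * p * (2 * i + ray j) : ℤ) : ℝ) + (m + 2 * φ * n)) / n := by
    field_simp
    push_cast
    linear_combination (2 * m * p : ℝ) * hlr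
  have hdiff : ((m : ℝ) * ((((p * (i + l) + p * J : ℤ) : ℝ) + 1 / 2 - τ) / n) + φ -
      ((m : ℝ) * ((((p * (i + l) : ℤ) : ℝ) + 1 / 2 + τ) / n) + φ)) =
      (m : ℝ) * (p * (J : ℕ) - 2 * τ) / n := by
    field_simp
    push_cast
    ring
  rw [hsum, hdiff, floor_int_add_div] at hval
  rcases Int.units_eq_one_or (ε i j) with h | h
  · rw [h, Int.negOnePow_even _ (hval.1 h)]
  · rw [h, Int.negOnePow_odd]
    rw [← Int.not_even_iff_odd, ← hval, h]
    decide

/-! ### Counting -/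

theorem exists_mem_waveClass {s n : ℕ} (hcop : Nat.Coprime s n) (hn : 2 * s + 1 ≤ n)
    {x : Quotient (identification s n)} (hx : x ∈ cylinderBraids s n) :
    ∃ (k : ℕ) (δ : Fin (s - 1) → ℤˣ), 2 * k ≤ n ∧ x = waveClass s n k 0 δ := by
  obtain ⟨ε, ⟨m, φ, -, hk, hε⟩, rfl⟩ := hx
  obtain ⟨q, c, δ, rfl⟩ := hε.exists_wavePattern hcop hn hk
  exact exists_waveClass_small_freq (by omega) q c δ

/-- Up to mirroring, the first sign of a wave is positive. -/
theorem exists_cons_waveClass {r n : ℕ} (k : ℕ) (δ : Fin (r + 2 - 1) → ℤˣ) :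
    ∃ η : Fin r → ℤˣ, waveClass (r + 2) n k 0 δ = waveClass (r + 2) n k 0 (Fin.cons 1 η) := by
  have key : ∀ δ : Fin (r + 1) → ℤˣ, δ 0 = 1 → Fin.cons 1 (Fin.tail δ) = δ := by
    intro δ h
    rw [← h, Fin.cons_self_tail]
  rcases Int.units_eq_one_or (δ (0 : Fin (r + 1))) with h | h
  · exact ⟨Fin.tail (n := r) δ, by rw [key δ h]⟩
  · refine ⟨Fin.tail (n := r) (-δ), ?_⟩
    rw [key (-δ) (by simp [h]), waveClass_neg_right]

/-- At half the maximal frequency, the first two signs of a wave can be made positive. -/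
theorem exists_cons_cons_waveClass {r n k : ℕ} (hn : 0 < n) (hk : 2 * k = n)
    (δ : Fin (r + 3 - 1) → ℤˣ) : ∃ η : Fin r → ℤˣ,
      waveClass (r + 3) n k 0 δ = waveClass (r + 3) n k 0 (Fin.cons 1 (Fin.cons 1 η)) := by
  have key : ∀ δ : Fin (r + 2) → ℤˣ, δ 0 = 1 → δ 1 = 1 →
      Fin.cons 1 (Fin.cons 1 (Fin.tail (Fin.tail δ))) = δ := by
    intro δ h0 h1
    have h1' : Fin.tail δ 0 = 1 := h1
    rw [← h1', Fin.cons_self_tail, h1', ← h0, Fin.cons_self_tail]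
  have t0 (δ : Fin (r + 2) → ℤˣ) : twist δ 0 = -δ 0 := by
    simp [twist, ray]
  have t1 (δ : Fin (r + 2) → ℤˣ) : twist δ 1 = δ 1 := by
    have : ¬ Odd (1 + 1) := by decide
    simp [twist, ray, this, Int.negOnePow_even _ even_two]
  -- Twisting changes only the first of these two signs and negation changes both, so together they
  -- reach all four combinations.
  obtain ⟨δ', h0, h1, hδ⟩ : ∃ δ' : Fin (r + 2) → ℤˣ, δ' 0 = 1 ∧ δ' 1 = 1 ∧
      waveClass (r + 3) n k 0 δ = waveClass (r + 3) n k 0 δ' := by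
    rcases Int.units_eq_one_or (δ (0 : Fin (r + 2))) with h | h <;>
      rcases Int.units_eq_one_or (δ (1 : Fin (r + 2))) with h' | h'
    · exact ⟨δ, h, h', rfl⟩
    · refine ⟨-twist δ, ?_, ?_, ?_⟩
      · rw [Pi.neg_apply, t0, h, neg_neg]
      · rw [Pi.neg_apply, t1, h', neg_neg]
      · rw [waveClass_neg_right, waveClass_twist_half hn _ hk]
    · refine ⟨twist δ, ?_, ?_, ?_⟩
      · rw [t0, h, neg_neg]
      · rw [t1, h']
      · rw [waveClass_twist_half hn _ hk]
    · refine ⟨-δ, ?_, ?_, ?_⟩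
      · rw [Pi.neg_apply, h, neg_neg]
      · rw [Pi.neg_apply, h', neg_neg]
      · rw [waveClass_neg_right]
  exact ⟨Fin.tail (Fin.tail δ'), by rw [key δ' h0 h1, hδ]⟩

theorem card_signs (r : ℕ) : Nat.card (Fin r → ℤˣ) = 2 ^ r := by
  simp

theorem ncard_range_le {α β : Type*} [Finite α] (f : α → β) : (Set.range f).ncard ≤ Nat.card α := by
  rw [← Set.image_univ, ← Set.ncard_univ]
  exact Set.ncard_image_le Set.finite_univ

theorem ncard_cylinderBraids_of_odd {r n : ℕ} (hcop : Nat.Coprime (r + 2) n)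
    (hn : 2 * (r + 2) + 1 ≤ n) (hodd : Odd n) :
    2 * (cylinderBraids (r + 2) n).ncard ≤ (n + 1) * 2 ^ r := by
  have hsub : cylinderBraids (r + 2) n ⊆ Set.range fun p : Fin (n / 2 + 1) × (Fin r → ℤˣ) =>
      waveClass (r + 2) n (p.1 : ℕ) 0 (Fin.cons 1 p.2) := by
    intro x hx
    obtain ⟨k, δ, hk, rfl⟩ := exists_mem_waveClass hcop hn hx
    obtain ⟨η, hη⟩ := exists_cons_waveClass (n := n) k δ
    exact ⟨(⟨k, by omega⟩, η), hη.symm⟩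
  have h := (Set.ncard_le_ncard hsub (Set.finite_range _)).trans (ncard_range_le _)
  rw [Nat.card_prod, card_signs, Nat.card_fin] at h
  obtain ⟨l, rfl⟩ := hodd
  rw [show (2 * l + 1) / 2 = l by omega] at h
  calc _ ≤ 2 * ((l + 1) * 2 ^ r) := by omega
    _ = _ := by ring

theorem ncard_cylinderBraids_of_even {r n : ℕ} (hcop : Nat.Coprime (r + 3) n)
    (hn : 2 * (r + 3) + 1 ≤ n) (heven : Even n) :
    (cylinderBraids (r + 3) n).ncard ≤ (n + 1) * 2 ^ r := by
  have hn0 : 0 < n := by omega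
  have hsub : cylinderBraids (r + 3) n ⊆ (Set.range fun p : Fin (n / 2) × (Fin (r + 1) → ℤˣ) =>
      waveClass (r + 3) n (p.1 : ℕ) 0 (Fin.cons 1 p.2)) ∪
      Set.range fun η : Fin r → ℤˣ =>
        waveClass (r + 3) n (n / 2 : ℕ) 0 (Fin.cons 1 (Fin.cons 1 η)) := by
    intro x hx
    obtain ⟨k, δ, hk, rfl⟩ := exists_mem_waveClass hcop hn hx
    rcases Nat.lt_or_ge k (n / 2) with h | h
    · left
      obtain ⟨η, hη⟩ := exists_cons_waveClass (r := r + 1) (n := n) k δ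
      exact ⟨(⟨k, h⟩, η), hη.symm⟩
    · right
      have hkn : k = n / 2 := by omega
      obtain ⟨l, hl⟩ := heven
      obtain ⟨η, hη⟩ := exists_cons_cons_waveClass (k := k) hn0 (by omega) δ
      exact ⟨η, by rw [hη, hkn]⟩
  have h := (Set.ncard_le_ncard hsub ((Set.finite_range _).union (Set.finite_range _))).trans
    ((Set.ncard_union_le _ _).trans (add_le_add (ncard_range_le _) (ncard_range_le _)))
  rw [Nat.card_prod, card_signs, card_signs, Nat.card_fin] at h
  obtain ⟨l, rfl⟩ := heven
  rw [show (l + l) / 2 = l by omega] at h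
  calc _ ≤ l * 2 ^ (r + 1) + 2 ^ r := h
    _ = _ := by ring

end CylinderBraid

theorem mainTheorem3 (s n : ℕ) (hs : 1 ≤ s) (hcop : Nat.Coprime s n) (hn : 2 * s + 1 ≤ n) :
    (CylinderBraid.cylinderBraids s n).Finite ∧
      ((CylinderBraid.cylinderBraids s n).ncard : ℝ) ≤ ((n : ℝ) + 1) * (2 : ℝ) ^ ((s : ℤ) - 3) := by
  have : NeZero n := ⟨by omega⟩
  refine ⟨Set.toFinite _, ?_⟩
  obtain rfl | ⟨r, rfl⟩ : s = 1 ∨ ∃ r, s = r + 2 := by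
    rcases Nat.lt_or_ge s 2 with h | h
    · exact Or.inl (by omega)
    · exact Or.inr ⟨s - 2, by omega⟩
  -- Without crossings there is only one pattern, and (n + 1)/4 ≥ 1 since n ≥ 3.
  · have : Subsingleton (CylinderBraid.Pattern 1 n) :=
      ⟨fun a b => funext fun _ => funext fun j => j.elim0⟩
    have h1 : (CylinderBraid.cylinderBraids 1 n).ncard ≤ 1 :=
      Set.ncard_le_one_of_subsingleton _
    have h2 : ((CylinderBraid.cylinderBraids 1 n).ncard : ℝ) ≤ 1 := by exact_mod_cast h1
    have h3 : (3 : ℝ) ≤ n := by exact_mod_cast hn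
    have h4 : (2 : ℝ) ^ (((1 : ℕ) : ℤ) - 3) = 1 / 4 := by norm_num [zpow_neg]
    rw [h4]
    linarith
  · have hpow : (2 : ℝ) ^ (((r + 2 : ℕ) : ℤ) - 3) = 2 ^ r / 2 := by
      rw [show ((r + 2 : ℕ) : ℤ) - 3 = (r : ℤ) - 1 by push_cast; ring,
        zpow_sub_one₀ two_ne_zero, zpow_natCast, div_eq_mul_inv]
    rw [hpow]
    have key : 2 * (CylinderBraid.cylinderBraids (r + 2) n).ncard ≤ (n + 1) * 2 ^ r := by
      rcases Nat.even_or_odd n with he | ho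
      · rcases r with _ | r
        -- For even n coprimality forces s to be odd, so s = 2 is excluded and two signs are
        -- available to normalise.
        · exact absurd hcop (by
            rw [Nat.coprime_two_left, Nat.not_odd_iff_even]; exact he)
        · have := CylinderBraid.ncard_cylinderBraids_of_even hcop hn he
          calc _ ≤ 2 * ((n + 1) * 2 ^ r) := Nat.mul_le_mul_left 2 this
            _ = _ := by ring
      · exact CylinderBraid.ncard_cylinderBraids_of_odd hcop hn ho
    have : (2 : ℝ) * (CylinderBraid.cylinderBraids (r + 2) n).ncard ≤ (n + 1) * 2 ^ r := by
      exact_mod_cast key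
    linarith
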